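/- Let $d,r\ge 0$ be integers, let $M_d$ be the complex $d\times d$ matrices, and for $B\in M_d^{\otimes(r+1)}$ put $$f_B(X_1,\dots,X_r)=\operatorname{tr}_{1\dots r}\big[B\,(X_1\otimes\cdots\otimes X_r\otimes 1)\big]\in M_d .$$ A trace polynomial in $X_1,\dots,X_r$ is a complex linear combination of monomials $X_{\alpha_1}\cdots X_{\alpha_m}\prod_{\beta}\operatorname{tr}(X_{\beta_1}\cdots X_{\beta_t})$ (an empty product of variables being the identity matrix); it is multilinear if each of the $r$ variables occurs exactly once in each of its monomials. A map $f:M_d^r\to M_d$ given by a multilinear trace polynomial is an inequality on the positive cone if $f(X_1,\dots,X_r)\ge 0$ for all positive semidefinite $X_1,\dots,X_r$; such an inequality is optimal if moreover the smallest eigenvalue of $f(\tilde X_1,\dots,\tilde X_r)$ is $0$ for some nonzero positive semidefinite $\tilde X_1,\dots,\tilde X_r$. An operator $B\in M_d^{\otimes(r+1)}$ is $U^{\otimes(r+1)}$-invariant if $B=U^{\otimes(r+1)}B(U^\dagger)^{\otimes(r+1)}$ for all unitary $U\in M_d$, and block-positive if $\operatorname{tr}[B\rho]\ge 0$ for every separable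 state $\rho$ (convex combination of tensor products of $r+1$ density matrices in $M_d$). A state is entangled if it is not separable. A Werner state witness is a $U^{\otimes(r+1)}$-invariant block-positive operator $W$ with $\operatorname{tr}[W\sigma]<0$ for some entangled $U^{\otimes(r+1)}$-invariant state $\sigma$; it is optimal if moreover $\operatorname{tr}[W\tilde\rho]=0$ for some separable state $\tilde\rho$. Theorem. 1. $B\mapsto f_B$ is a bijection from the set of $U^{\otimes(r+1)}$-invariant block-positive operators $B\in M_d^{\otimes(r+1)}$ onto the set of maps $M_d^r\to M_d$ that are given by multilinear trace polynomials and are inequalities on the positive cone. 2. For every $B\in M_d^{\otimes(r+1)}$, the map $f_B$ is an optimal multilinear trace polynomial inequality on the positive cone if and only if $B$ is $U^{\otimes(r+1)}$-invariant and block-positive and $\operatorname{tr}[B\tilde\rho]=0$ for some separable state $\tilde\rho$. 3. For every $B\in M_d^{\otimes(r+1)}$, the operator $B$ is an optimal Werner state witness if and only if $f_B$ is an optimal multilinear trace polynomial inequality on the positive cone and $B$ is not positive semidefinite. In particular, for a Werner state witness $W$, the inequality $f_W$ is optimal if and only if $W$ is an optimal witness. -/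

import Mathlib

open scoped ComplexOrder Matrix

noncomputable section

/-- Complex `d × d` matrices. -/
abbrev Mat (d : ℕ) : Type := Matrix (Fin d) (Fin d) ℂ

/-- Operators on the `k`-fold tensor power of `ℂ^d`, as matrices in the product basis: a basis
vector `e_{i 0} ⊗ ⋯ ⊗ e_{i (k-1)}` is indexed by the function `i : Fin k → Fin d`. -/
abbrev TensorMat (d k : ℕ) : Type := Matrix (Fin k → Fin d) (Fin k → Fin d) ℂ

/-- The operator `A 0 ⊗ ⋯ ⊗ A (k-1)`. -/
def tensorProd {d k : ℕ} (A : Fin k → Mat d) : TensorMat d k :=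
  Matrix.of fun i j => ∏ s, A s (i s) (j s)

/-- Partial trace over the first `r` of `r + 1` tensor factors. -/
def partialTrace {d r : ℕ} (M : TensorMat d (r + 1)) : Mat d :=
  Matrix.of fun a b => ∑ i : Fin r → Fin d,
    M (Fin.snoc (α := fun _ => Fin d) i a) (Fin.snoc (α := fun _ => Fin d) i b)

/-- The map `f_B (X_1, …, X_r) = tr_{1…r} [B (X_1 ⊗ ⋯ ⊗ X_r ⊗ 1)]`. -/
def inducedMap {d r : ℕ} (B : TensorMat d (r + 1)) : (Fin r → Mat d) → Mat d :=
  fun X => partialTrace (B * tensorProd (Fin.snoc (α := fun _ => Mat d) X 1))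

/-! ### Trace polynomials -/

/-- A monomial `X_{α_1} ⋯ X_{α_m} ∏_β tr (X_{β_1} ⋯ X_{β_t})` in the variables `X_0, …, X_{r-1}`.
An empty word stands for the identity matrix. -/
structure TraceMonomial (r : ℕ) where
  word : List (Fin r)
  traces : Multiset (List (Fin r))

/-- The multiset of variables occurring in a trace monomial, inside and outside the traces. -/
def TraceMonomial.letters {r : ℕ} (m : TraceMonomial r) : Multiset (Fin r) :=
  (m.word : Multiset (Fin r)) + (m.traces.map fun w => (w : Multiset (Fin r))).sum

/-- The value of a trace monomial at a tuple of matrices. -/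
def TraceMonomial.eval {d r : ℕ} (m : TraceMonomial r) (X : Fin r → Mat d) : Mat d :=
  (m.traces.map fun w => ((w.map X).prod).trace).prod • (m.word.map X).prod

/-- Trace polynomials: finite complex linear combinations of trace monomials. -/
abbrev TracePolynomial (r : ℕ) : Type := TraceMonomial r →₀ ℂ

/-- The map on `d × d` matrices given by a trace polynomial. -/
def TracePolynomial.eval {r : ℕ} (d : ℕ) (p : TracePolynomial r) : (Fin r → Mat d) → Mat d :=
  fun X => p.sum fun m c => c • m.eval X

/-- A trace polynomial is multilinear if each of the variables occurs exactly once in each of its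
monomials. -/
def TracePolynomial.IsMultilinear {r : ℕ} (p : TracePolynomial r) : Prop :=
  ∀ m ∈ p.support, m.letters = (Finset.univ : Finset (Fin r)).val

/-- `f` is given by a multilinear trace polynomial and is an inequality on the positive cone. -/
def IsTraceInequality {d r : ℕ} (f : (Fin r → Mat d) → Mat d) : Prop :=
  (∃ p : TracePolynomial r, p.IsMultilinear ∧ f = p.eval d) ∧
    ∀ X : Fin r → Mat d, (∀ i, (X i).PosSemidef) → (f X).PosSemidef

/-- `t` is the smallest eigenvalue of `A` (used for Hermitian `A`, all of whose eigenvalues are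
real). -/
def IsMinEigenvalue {d : ℕ} (A : Mat d) (t : ℝ) : Prop :=
  IsLeast (spectrum ℝ A) t

/-- A multilinear trace polynomial inequality whose smallest eigenvalue vanishes at some tuple of
nonzero positive semidefinite matrices. -/
def IsOptimalTraceInequality {d r : ℕ} (f : (Fin r → Mat d) → Mat d) : Prop :=
  IsTraceInequality f ∧
    ∃ X : Fin r → Mat d, (∀ i, (X i).PosSemidef ∧ X i ≠ 0) ∧ IsMinEigenvalue (f X) 0

/-! ### States and witnesses -/

/-- Density matrices. -/
def IsState {ι : Type*} [Fintype ι] (ρ : Matrix ι ι ℂ) : Prop :=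
  ρ.PosSemidef ∧ ρ.trace = 1

/-- Separable states: convex combinations of product states. -/
def IsSeparableState {d k : ℕ} (ρ : TensorMat d k) : Prop :=
  ρ ∈ convexHull ℝ {τ : TensorMat d k | ∃ σ : Fin k → Mat d,
    (∀ s, IsState (σ s)) ∧ τ = tensorProd σ}

/-- Entangled states: states that are not separable. -/
def IsEntangledState {d k : ℕ} (ρ : TensorMat d k) : Prop :=
  IsState ρ ∧ ¬ IsSeparableState ρ

/-- Invariance under `U^{⊗k}` for all unitaries `U`. -/
def IsUnitaryInvariant {d k : ℕ} (B : TensorMat d k) : Prop :=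
  ∀ U ∈ Matrix.unitaryGroup (Fin d) ℂ,
    B = tensorProd (fun _ : Fin k => U) * B * tensorProd (fun _ : Fin k => Uᴴ)

/-- `tr [B ρ]` is real and nonnegative for all separable states `ρ`. -/
def IsBlockPositive {d k : ℕ} (B : TensorMat d k) : Prop :=
  ∀ ρ : TensorMat d k, IsSeparableState ρ → 0 ≤ (B * ρ).trace

/-- The expectation value vanishes on some separable state. -/
def VanishesOnSeparable {d k : ℕ} (B : TensorMat d k) : Prop :=
  ∃ ρ : TensorMat d k, IsSeparableState ρ ∧ (B * ρ).trace = 0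

/-- Werner state witness: a unitarily invariant block-positive operator that detects some entangled
unitarily invariant state. -/
def IsWernerWitness {d k : ℕ} (W : TensorMat d k) : Prop :=
  IsUnitaryInvariant W ∧ IsBlockPositive W ∧
    ∃ σ : TensorMat d k, IsEntangledState σ ∧ IsUnitaryInvariant σ ∧ (W * σ).trace < 0

/-- A Werner state witness that vanishes on some separable state. -/
def IsOptimalWernerWitness {d k : ℕ} (W : TensorMat d k) : Prop :=
  IsWernerWitness W ∧ VanishesOnSeparable W

end

/-!
The pairing `tr [f_B (X_1, …, X_r) Y] = tr [B (X_1 ⊗ ⋯ ⊗ X_r ⊗ Y)]` (`trace_inducedMap_mul`)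
translates every property of `f_B` into a property of `B` tested on product operators. It shows that
`B ↦ f_B` is injective, that every multilinear map is some `f_B` (`exists_inducedMap_eq`), and, with
`Y = v v^†`, that `f_B` is an inequality on the positive cone exactly when `B` is block-positive
(`isBlockPositive_iff_inducedMap`).

Unitary invariance of `B` corresponds to `f_B` being a multilinear trace polynomial. One direction is
equivariance of trace polynomials (`isUnitaryInvariant_of_eval`). The other is Schur–Weyl duality in
the form that an invariant operator is a combination of permutation operators
(`IsUnitaryInvariant.mem_span_permOp`), together with the fact that a permutation operator induces a
trace monomial, whose words are read off from the cycles (`exists_traceMonomial_permOp`). The proof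
of Schur–Weyl duality: an invariant `B` commutes with `D^{⊗k}` for unitary diagonal `D`, hence for
all diagonal `D` since this is a polynomial condition, hence with `H^{⊗k}` for Hermitian `H` by the
spectral theorem, hence with all symmetrized tensor products by polarization and because Hermitian
matrices span. Subtracting the orthogonal projection of `B` onto the span of the permutation
operators leaves an operator with the same commutation property that is orthogonal to all permutation
operators, and such an operator is zero (`CommutesWithSymmetrized.eq_zero`).

For optimality, a block-positive `B` vanishing on a separable state vanishes on a product state `σ`,
and then the positive semidefinite matrix `f_B (σ_1, …, σ_r)` has the columns of the last factor in
its kernel; conversely a kernel vector `v` of `f_B (X)` gives the product `X_1 ⊗ ⋯ ⊗ X_r ⊗ v v^†` on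
which `B` vanishes. Finally, an invariant block-positive operator that is not positive semidefinite
is Hermitian, and its normalized negative part is an invariant state on which it is negative
(`exists_state_trace_neg`); block-positivity makes this state entangled.
-/

noncomputable section

/-! ### Tensor products and the trace pairing -/

theorem tensorProd_mul {d k : ℕ} (A B : Fin k → Mat d) :
    tensorProd A * tensorProd B = tensorProd fun s => A s * B s := by
  ext i j
  simp only [tensorProd, Matrix.mul_apply, Matrix.of_apply, ← Finset.prod_mul_distrib]
  rw [Finset.prod_univ_sum, Fintype.piFinset_univ]

theorem tensorProd_one {d k : ℕ} : tensorProd (fun _ : Fin k => (1 : Mat d)) = 1 := by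
  ext i j
  simp only [tensorProd, Matrix.of_apply, Matrix.one_apply, Finset.prod_ite_zero,
    Finset.prod_const_one, Finset.mem_univ, true_implies, funext_iff]

theorem tensorProd_conjTranspose {d k : ℕ} (A : Fin k → Mat d) :
    (tensorProd A)ᴴ = tensorProd fun s => (A s)ᴴ := by
  ext i j
  simp [tensorProd]

theorem tensorProd_single {d k : ℕ} (p q : Fin k → Fin d) :
    tensorProd (fun s => Matrix.single (p s) (q s) (1 : ℂ)) = Matrix.single p q 1 := by
  ext i j
  simp only [tensorProd, Matrix.of_apply, Matrix.single_apply, Finset.prod_ite_zero,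
    Finset.prod_const_one, Finset.mem_univ, true_implies, funext_iff, forall_and]

theorem tensorProd_smul {d k : ℕ} (c : Fin k → ℂ) (A : Fin k → Mat d) :
    tensorProd (fun s => c s • A s) = (∏ s, c s) • tensorProd A := by
  ext i j
  simp [tensorProd, Finset.prod_mul_distrib]

/-- The tensor product of matrices, as a multilinear map. -/
def tensorProdMultilinear (d k : ℕ) :
    MultilinearMap ℂ (fun _ : Fin k => Mat d) (TensorMat d k) where
  toFun := tensorProd
  map_update_add' A s x y := by
    ext i j
    simp only [tensorProd, Matrix.of_apply, Matrix.add_apply,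
      ← Finset.mul_prod_erase _ _ (Finset.mem_univ s), Function.update_self, add_mul]
    congr 2 <;> refine Finset.prod_congr rfl fun t ht => ?_ <;>
      simp [Function.update_of_ne (Finset.ne_of_mem_erase ht)]
  map_update_smul' A s c x := by
    ext i j
    simp only [tensorProd, Matrix.of_apply, Matrix.smul_apply, smul_eq_mul,
      ← Finset.mul_prod_erase _ _ (Finset.mem_univ s), Function.update_self, mul_assoc]
    congr 2; refine Finset.prod_congr rfl fun t ht => ?_
    simp [Function.update_of_ne (Finset.ne_of_mem_erase ht)]

@[simp]
theorem tensorProdMultilinear_apply {d k : ℕ} (A : Fin k → Mat d) :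
    tensorProdMultilinear d k A = tensorProd A := rfl

/-- The linear form `M ↦ tr [B M]`. -/
def traceForm {d k : ℕ} (B : TensorMat d k) : TensorMat d k →ₗ[ℂ] ℂ :=
  Matrix.traceLinearMap _ ℂ ℂ ∘ₗ LinearMap.mulLeft ℂ B

theorem eq_of_trace_mul_tensorProd {d k : ℕ} {B C : TensorMat d k}
    (h : ∀ A : Fin k → Mat d, (B * tensorProd A).trace = (C * tensorProd A).trace) : B = C := by
  ext p q
  have := h fun s => Matrix.single (q s) (p s) 1
  simpa [tensorProd_single, Matrix.trace_mul_single] using this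

theorem sum_snoc {d r : ℕ} {M : Type*} [AddCommMonoid M] (F : (Fin (r + 1) → Fin d) → M) :
    ∑ x, F x = ∑ i : Fin r → Fin d, ∑ a : Fin d, F (Fin.snoc (α := fun _ => Fin d) i a) := by
  rw [Finset.sum_comm, ← Fintype.sum_prod_type', ← (Fin.snocEquiv fun _ => Fin d).sum_comp]
  rfl

theorem tensorProd_snoc_apply {d r : ℕ} (X : Fin r → Mat d) (Y : Mat d) (i j : Fin r → Fin d)
    (a b : Fin d) :
    tensorProd (Fin.snoc (α := fun _ => Mat d) X Y) (Fin.snoc (α := fun _ => Fin d) i a)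
      (Fin.snoc (α := fun _ => Fin d) j b) = tensorProd X i j * Y a b := by
  simp [tensorProd, Fin.prod_univ_castSucc]

theorem inducedMap_apply {d r : ℕ} (B : TensorMat d (r + 1)) (X : Fin r → Mat d) (a b : Fin d) :
    inducedMap B X a b = ∑ i : Fin r → Fin d, ∑ j : Fin r → Fin d,
      B (Fin.snoc (α := fun _ => Fin d) i a) (Fin.snoc (α := fun _ => Fin d) j b) *
        tensorProd X j i := by
  simp only [inducedMap, partialTrace, Matrix.of_apply, Matrix.mul_apply, sum_snoc,
    tensorProd_snoc_apply, Matrix.one_apply]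
  simp

/-- The defining adjunction of the partial trace: `B` and `f_B` carry the same information through
the pairing with product operators. -/
theorem trace_inducedMap_mul {d r : ℕ} (B : TensorMat d (r + 1)) (X : Fin r → Mat d) (Y : Mat d) :
    (inducedMap B X * Y).trace
      = (B * tensorProd (Fin.snoc (α := fun _ => Mat d) X Y)).trace := by
  simp only [Matrix.trace, Matrix.diag, Matrix.mul_apply, sum_snoc, tensorProd_snoc_apply,
    inducedMap_apply, Finset.sum_mul]
  conv_rhs => rw [Finset.sum_comm]
  refine Finset.sum_congr rfl fun a _ => ?_
  rw [Finset.sum_comm]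
  refine Finset.sum_congr rfl fun i _ => ?_
  rw [Finset.sum_comm]
  refine Finset.sum_congr rfl fun j _ => Finset.sum_congr rfl fun b _ => by ring

/-- `B` is determined by `f_B`, since product operators span. -/
theorem inducedMap_injective {d r : ℕ} :
    Function.Injective (inducedMap : TensorMat d (r + 1) → (Fin r → Mat d) → Mat d) := by
  intro B C h
  refine eq_of_trace_mul_tensorProd fun A => ?_
  rw [← Fin.snoc_init_self A, ← trace_inducedMap_mul, ← trace_inducedMap_mul, h]

/-- `f_B` as a multilinear map. -/
def inducedMultilinear {d r : ℕ} (B : TensorMat d (r + 1)) :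
    MultilinearMap ℂ (fun _ : Fin r => Mat d) (Mat d) where
  toFun := inducedMap B
  map_update_add' X s x y := by
    ext a b
    simp only [inducedMap_apply, Matrix.add_apply, ← tensorProdMultilinear_apply,
      MultilinearMap.map_update_add, mul_add, Finset.sum_add_distrib]
  map_update_smul' X s c x := by
    ext a b
    simp only [inducedMap_apply, Matrix.smul_apply, ← tensorProdMultilinear_apply,
      MultilinearMap.map_update_smul, Finset.mul_sum, smul_eq_mul, mul_left_comm]

/-- Every multilinear map `M_d^r → M_d` is of the form `f_B`: the entries of `B` are the values of
the map at the matrix units. -/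
theorem exists_inducedMap_eq {d r : ℕ} (f : MultilinearMap ℂ (fun _ : Fin r => Mat d) (Mat d)) :
    ∃ B : TensorMat d (r + 1), inducedMap B = f := by
  let B : TensorMat d (r + 1) := Matrix.of fun x y =>
    f (fun s => Matrix.single (y s.castSucc) (x s.castSucc) 1) (x (Fin.last r)) (y (Fin.last r))
  refine ⟨B, ?_⟩
  suffices inducedMultilinear B = f from congrArg DFunLike.coe this
  refine Module.Basis.ext_multilinear (fun _ => Matrix.stdBasis ℂ (Fin d) (Fin d)) fun v => ?_
  have hv : (fun s => Matrix.stdBasis ℂ (Fin d) (Fin d) (v s))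
      = fun s => Matrix.single (v s).1 (v s).2 1 :=
    funext fun s => Matrix.stdBasis_eq_single _ _ _
  rw [hv]
  ext a b
  change inducedMap B _ a b = _
  rw [inducedMap_apply, tensorProd_single]
  simp [B, Matrix.single_apply, ite_and]

/-! ### Positive semidefinite matrices separate operators -/

section
open scoped Matrix.Norms.L2Operator MatrixOrder

theorem span_posSemidef (d : ℕ) : Submodule.span ℂ {A : Mat d | A.PosSemidef} = ⊤ := by
  have := CStarAlgebra.span_nonneg (A := Mat d)
  simpa only [Matrix.nonneg_iff_posSemidef] using this

end

/-- Positive semidefinite matrices span all matrices, so a multilinear map is determined by its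
values on them. -/
theorem multilinear_ext_posSemidef {d k : ℕ} {N : Type*} [AddCommGroup N] [Module ℂ N]
    {f g : MultilinearMap ℂ (fun _ : Fin k => Mat d) N}
    (h : ∀ A : Fin k → Mat d, (∀ s, (A s).PosSemidef) → f A = g A) : f = g := by
  have hs := (span_posSemidef d).ge
  refine Module.Basis.ext_multilinear (fun _ => Module.Basis.ofSpan hs) fun v => h _ fun s => ?_
  exact Module.Basis.ofSpan_subset hs ⟨_, rfl⟩

theorem eq_of_trace_mul_tensorProd_posSemidef {d k : ℕ} {B C : TensorMat d k}
    (h : ∀ A : Fin k → Mat d, (∀ s, (A s).PosSemidef) →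
      (B * tensorProd A).trace = (C * tensorProd A).trace) : B = C := by
  have := multilinear_ext_posSemidef
    (f := (traceForm B).compMultilinearMap (tensorProdMultilinear d k))
    (g := (traceForm C).compMultilinearMap (tensorProdMultilinear d k)) h
  exact eq_of_trace_mul_tensorProd fun A => congrArg (fun f => f A) this

/-! ### Unitarily invariant operators are combinations of permutation operators -/

theorem IsUnitaryInvariant.commute {d k : ℕ} {B : TensorMat d k} (hB : IsUnitaryInvariant B)
    {U : Mat d} (hU : U ∈ Matrix.unitaryGroup (Fin d) ℂ) :
    Commute B (tensorProd fun _ => U) := by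
  have h := hB U hU
  have hU' : Uᴴ * U = 1 := Matrix.mem_unitaryGroup_iff'.1 hU
  calc B * tensorProd (fun _ => U)
      = tensorProd (fun _ => U) * B * (tensorProd (fun _ => Uᴴ) * tensorProd fun _ => U) := by
        rw [← mul_assoc, ← h]
    _ = tensorProd (fun _ => U) * B := by
        rw [tensorProd_mul, hU', tensorProd_one, mul_one]

theorem isUnitaryInvariant_of_commute {d k : ℕ} {B : TensorMat d k}
    (hB : ∀ U ∈ Matrix.unitaryGroup (Fin d) ℂ, Commute B (tensorProd fun _ => U)) :
    IsUnitaryInvariant B := by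
  intro U hU
  have hU' : U * Uᴴ = 1 := Matrix.mem_unitaryGroup_iff.1 hU
  rw [← (hB U hU).eq, mul_assoc, tensorProd_mul, hU', tensorProd_one, mul_one]

theorem tensorProd_diagonal {d k : ℕ} (z : Fin d → ℂ) :
    tensorProd (fun _ : Fin k => Matrix.diagonal z)
      = Matrix.diagonal fun x : Fin k → Fin d => ∏ s, z (x s) := by
  ext x y
  simp only [tensorProd, Matrix.of_apply, Matrix.diagonal_apply, Finset.prod_ite_zero,
    Finset.mem_univ, true_implies, funext_iff]

/-- Commutation with `diag (z)^{⊗k}` is a polynomial condition in `z`; it holds on the torus, hence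
everywhere. -/
theorem IsUnitaryInvariant.commute_diagonal {d k : ℕ} {B : TensorMat d k}
    (hB : IsUnitaryInvariant B) (z : Fin d → ℂ) :
    Commute B (tensorProd fun _ => Matrix.diagonal z) := by
  have key : ∀ x y : Fin k → Fin d,
      MvPolynomial.C (B x y) * ∏ s, MvPolynomial.X (y s)
        = (∏ s, MvPolynomial.X (x s)) * MvPolynomial.C (B x y) := by
    intro x y
    refine MvPolynomial.funext_set (fun _ => Metric.sphere (0 : ℂ) 1) (fun _ => ?_) fun w hw => ?_
    · have : Infinite Circle := Circle.argEquiv.infinite_iff.2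
        (Set.infinite_coe_iff.2 (Set.Ioc_infinite (by linarith [Real.pi_pos])))
      exact Set.infinite_coe_iff.1 (inferInstanceAs (Infinite Circle))
    · have hU : Matrix.diagonal w ∈ Matrix.unitaryGroup (Fin d) ℂ := by
        rw [Matrix.mem_unitaryGroup_iff', Matrix.star_eq_conjTranspose,
          Matrix.diagonal_conjTranspose, Matrix.diagonal_mul_diagonal, ← Matrix.diagonal_one]
        congr 1
        ext a
        have : ‖w a‖ = 1 := by simpa using hw a trivial
        simp [← Complex.normSq_eq_conj_mul_self, Complex.normSq_eq_norm_sq, this]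
      have := congrFun₂ (hB.commute hU).eq x y
      simpa [tensorProd_diagonal] using this
  ext x y
  have := congrArg (MvPolynomial.eval z) (key x y)
  simpa [tensorProd_diagonal] using this

/-- By the spectral theorem, commutation with `H^{⊗k}` reduces to the unitary and the diagonal
case. -/
theorem IsUnitaryInvariant.commute_isHermitian {d k : ℕ} {B : TensorMat d k}
    (hB : IsUnitaryInvariant B) {H : Mat d} (hH : H.IsHermitian) :
    Commute B (tensorProd fun _ => H) := by
  have h := hH.spectral_theorem
  rw [Unitary.conjStarAlgAut_apply] at h
  rw [h, ← tensorProd_mul, ← tensorProd_mul]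
  refine ((hB.commute hH.eigenvectorUnitary.2).mul_right (hB.commute_diagonal _)).mul_right
    (hB.commute (star hH.eigenvectorUnitary).2)

/-- Polarization: if a linear form annihilates the tensor power of every real combination of the
`H s`, then it annihilates their symmetrized tensor product, which is the mixed derivative of that
power in the coefficients. -/
theorem sum_perm_tensorProd_eq_zero {d k : ℕ} (φ : TensorMat d k →ₗ[ℂ] ℂ) (H : Fin k → Mat d)
    (h : ∀ t : Fin k → ℝ, φ (tensorProd fun _ => ∑ s, t s • H s) = 0) :
    ∑ π : Equiv.Perm (Fin k), φ (tensorProd fun s => H (π s)) = 0 := by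
  let L : (Fin k → ℝ) →ₗ[ℝ] Mat d := Fintype.linearCombination ℝ H
  let M : MultilinearMap ℝ (fun _ : Fin k => Fin k → ℝ) ℂ :=
    ((φ.compMultilinearMap (tensorProdMultilinear d k)).restrictScalars ℝ).compLinearMap fun _ => L
  have hM : ∀ v, M v = φ (tensorProd fun s => L (v s)) := fun v => rfl
  have hL : ∀ i j, Continuous fun t => L t i j := fun i j =>
    (Matrix.entryLinearMap ℝ ℂ i j ∘ₗ L).continuous_of_finiteDimensional
  have hφ : Continuous φ := φ.continuous_of_finiteDimensional
  have hcont : Continuous M := by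
    have : Continuous fun v : Fin k → Fin k → ℝ => tensorProd fun s => L (v s) := by
      refine continuous_matrix fun i j => ?_
      simp only [tensorProd, Matrix.of_apply]
      exact continuous_finsetProd Finset.univ fun s _ => (hL (i s) (j s)).comp (continuous_apply s)
    exact hφ.comp this
  let M' : ContinuousMultilinearMap ℝ (fun _ : Fin k => Fin k → ℝ) ℂ := ⟨M, hcont⟩
  have hzero : (fun t : Fin k → ℝ => M' fun _ => t) = fun _ => 0 := by
    funext t
    exact h t
  have := M'.iteratedFDeriv_comp_diagonal 0 fun s => Pi.single s 1
  rw [hzero, iteratedFDeriv_fun_zero] at this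
  refine Eq.trans ?_ this.symm
  refine Finset.sum_congr rfl fun π _ => ?_
  change _ = φ (tensorProd fun s => L (Pi.single (π s) 1))
  simp [L, Fintype.linearCombination_apply_single]

/-- An invariant operator commutes with all symmetrized tensor products. Polarization gives this for
Hermitian factors, and both sides are multilinear. -/
theorem IsUnitaryInvariant.commute_sum_perm {d k : ℕ} {B : TensorMat d k}
    (hB : IsUnitaryInvariant B) (A : Fin k → Mat d) :
    Commute B (∑ π : Equiv.Perm (Fin k), tensorProd fun s => A (π s)) := by
  let sym : MultilinearMap ℂ (fun _ : Fin k => Mat d) (TensorMat d k) :=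
    ∑ π : Equiv.Perm (Fin k), (tensorProdMultilinear d k).domDomCongr π
  let comm : TensorMat d k →ₗ[ℂ] TensorMat d k := LinearMap.mulLeft ℂ B - LinearMap.mulRight ℂ B
  have hsym : ∀ A, sym A = ∑ π : Equiv.Perm (Fin k), tensorProd fun s => A (π s) := by
    intro A
    simp only [sym, FunLike.coe_sum, Finset.sum_apply]
    rfl
  have hz : comm.compMultilinearMap sym = 0 := by
    refine multilinear_ext_posSemidef fun A hA => ?_
    ext x y
    have := sum_perm_tensorProd_eq_zero (Matrix.entryLinearMap ℂ ℂ x y ∘ₗ comm) A fun t => by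
      have hH : (∑ s, t s • A s).IsHermitian :=
        isSelfAdjoint_sum _ fun s _ => (IsSelfAdjoint.all (t s)).smul (hA s).isHermitian
      have := (hB.commute_isHermitian hH).eq
      simp [comm, this]
    rw [LinearMap.compMultilinearMap_apply, hsym, map_sum, Matrix.sum_apply]
    exact this
  have := congrArg (fun f => f A) hz
  rw [LinearMap.compMultilinearMap_apply, hsym] at this
  exact sub_eq_zero.1 this

/-- The permutation operator sending `e_y` to `e_{y ∘ σ}`. -/
def permOp (d : ℕ) {k : ℕ} (σ : Equiv.Perm (Fin k)) : TensorMat d k :=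
  Matrix.of fun x y => if x = y ∘ σ then 1 else 0

/-- Commutation with the symmetrized tensor products of the matrix units `E_{p s, q s}`, written out
in entries. -/
def CommutesWithSymmetrized {d k : ℕ} (C : TensorMat d k) : Prop :=
  ∀ x y p q : Fin k → Fin d,
    ∑ π : Equiv.Perm (Fin k), C x (p ∘ π) * (if q ∘ π = y then 1 else 0)
      = ∑ π : Equiv.Perm (Fin k), (if p ∘ π = x then 1 else 0) * C (q ∘ π) y

theorem IsUnitaryInvariant.commutesWithSymmetrized {d k : ℕ} {B : TensorMat d k}
    (hB : IsUnitaryInvariant B) : CommutesWithSymmetrized B := by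
  intro x y p q
  have h := (hB.commute_sum_perm fun s => Matrix.single (p s) (q s) 1).eq
  have hs : ∀ π : Equiv.Perm (Fin k),
      tensorProd (fun s => Matrix.single (p (π s)) (q (π s)) (1 : ℂ))
        = Matrix.single (p ∘ π) (q ∘ π) 1 := fun π => tensorProd_single (p ∘ π) (q ∘ π)
  simp only [hs, Finset.mul_sum, Finset.sum_mul] at h
  have h := congrFun₂ h x y
  simpa [Matrix.sum_apply, Matrix.mul_apply, Matrix.single_apply, ite_and, eq_comm] using h

theorem permOp_commutesWithSymmetrized {d k : ℕ} (σ : Equiv.Perm (Fin k)) :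
    CommutesWithSymmetrized (permOp d σ) := by
  intro x y p q
  rw [← Equiv.sum_comp (Equiv.mulRight σ) fun π : Equiv.Perm (Fin k) =>
    (if p ∘ π = x then (1 : ℂ) else 0) * permOp d σ (q ∘ π) y]
  refine Finset.sum_congr rfl fun π _ => ?_
  have h : q ∘ π ∘ σ = y ∘ σ ↔ q ∘ π = y := by
    rw [← Function.comp_assoc, σ.surjective.injective_comp_right.eq_iff]
  simp only [permOp, Matrix.of_apply, Equiv.coe_mulRight, Equiv.Perm.coe_mul,
    Function.comp_assoc, h, eq_comm (a := x)]
  congr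

theorem CommutesWithSymmetrized.add {d k : ℕ} {B C : TensorMat d k}
    (hB : CommutesWithSymmetrized B) (hC : CommutesWithSymmetrized C) :
    CommutesWithSymmetrized (B + C) := by
  intro x y p q
  simp only [Matrix.add_apply, add_mul, mul_add, Finset.sum_add_distrib, hB x y p q, hC x y p q]

theorem CommutesWithSymmetrized.smul {d k : ℕ} {B : TensorMat d k} (c : ℂ)
    (hB : CommutesWithSymmetrized B) : CommutesWithSymmetrized (c • B) := by
  intro x y p q
  simp only [Matrix.smul_apply, smul_eq_mul, mul_assoc, mul_left_comm _ c, ← Finset.mul_sum,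
    hB x y p q]

theorem CommutesWithSymmetrized.sub {d k : ℕ} {B C : TensorMat d k}
    (hB : CommutesWithSymmetrized B) (hC : CommutesWithSymmetrized C) :
    CommutesWithSymmetrized (B - C) := by
  intro x y p q
  simp only [Matrix.sub_apply, sub_mul, mul_sub, Finset.sum_sub_distrib, hB x y p q, hC x y p q]

/-- Summation over two variables that are fixed by indicator functions in the two factors. -/
theorem sum_sum_mul_indicator {T P X Y : Type*} [Fintype T] [Fintype P] [Fintype X] [Fintype Y]
    [DecidableEq X] [DecidableEq Y] (u : T → X → ℂ) (v : P → Y → ℂ) (f : T → Y) (g : P → X) :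
    ∑ x, ∑ y, (∑ τ, u τ x * if f τ = y then 1 else 0) * (∑ π, (if g π = x then 1 else 0) * v π y)
      = ∑ τ, ∑ π, u τ (g π) * v π (f τ) := by
  simp only [Finset.sum_mul_sum]
  simp_rw [Finset.sum_comm (s := (Finset.univ : Finset Y))]
  rw [Finset.sum_comm]
  refine Finset.sum_congr rfl fun τ _ => ?_
  rw [Finset.sum_comm]
  refine Finset.sum_congr rfl fun π _ => ?_
  simp

/-- The heart of the double commutant argument: an operator commuting with the symmetrized tensor
products and orthogonal to all permutation operators vanishes. With `h` the common value of both
sides of the commutation identity, `∑ |h|²`, written with the left side in one factor and the right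
side in the other, becomes a sum of products of pairings with permutation operators. -/
theorem CommutesWithSymmetrized.eq_zero {d k : ℕ} {C : TensorMat d k}
    (hC : CommutesWithSymmetrized C) (horth : ∀ σ : Equiv.Perm (Fin k), ∑ x, C x (x ∘ σ) = 0) :
    C = 0 := by
  let h : (Fin k → Fin d) → (Fin k → Fin d) → (Fin k → Fin d) → (Fin k → Fin d) → ℂ :=
    fun x y p q => ∑ π : Equiv.Perm (Fin k), C x (p ∘ π) * (if q ∘ π = y then 1 else 0)
  have hsum : ∑ p, ∑ q, ∑ x, ∑ y, star (h x y p q) * h x y p q = 0 := by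
    have hprod : ∀ p q, ∑ x, ∑ y, star (h x y p q) * h x y p q
        = ∑ τ : Equiv.Perm (Fin k), ∑ π : Equiv.Perm (Fin k),
          star (C (p ∘ π) (p ∘ τ)) * C (q ∘ π) (q ∘ τ) := by
      intro p q
      rw [← sum_sum_mul_indicator (fun (τ : Equiv.Perm (Fin k)) x => star (C x (p ∘ τ)))
        (fun (π : Equiv.Perm (Fin k)) y => C (q ∘ π) y) (fun τ => q ∘ τ) (fun π => p ∘ π)]
      refine Finset.sum_congr rfl fun x _ => Finset.sum_congr rfl fun y _ => ?_
      rw [← hC x y p q]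
      refine congrArg (· * h x y p q) ?_
      rw [show h x y p q = _ from rfl, star_sum]
      refine Finset.sum_congr rfl fun τ _ => ?_
      split_ifs <;> simp
    have hpair : ∀ τ π : Equiv.Perm (Fin k), ∑ q, C (q ∘ π) (q ∘ τ) = 0 := by
      intro τ π
      rw [← horth (π⁻¹ * τ), ← Equiv.sum_comp (π.arrowCongr (Equiv.refl (Fin d)))]
      refine Finset.sum_congr rfl fun q _ => ?_
      congr 1; ext s; simp
    simp only [hprod]
    refine Finset.sum_eq_zero fun p _ => ?_
    rw [Finset.sum_comm]
    refine Finset.sum_eq_zero fun τ _ => ?_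
    rw [Finset.sum_comm]
    refine Finset.sum_eq_zero fun π _ => ?_
    rw [← Finset.mul_sum, hpair, mul_zero]
  have hzero : ∀ x y p q, h x y p q = 0 := by
    intro x y p q
    have hnn : ∀ z : ℂ, 0 ≤ star z * z := star_mul_self_nonneg
    rw [Fintype.sum_eq_zero_iff_of_nonneg fun p => Finset.sum_nonneg fun q _ =>
      Finset.sum_nonneg fun x _ => Finset.sum_nonneg fun y _ => hnn _] at hsum
    have hsum := congrFun hsum p
    rw [Pi.zero_apply, Fintype.sum_eq_zero_iff_of_nonneg fun q =>
      Finset.sum_nonneg fun x _ => Finset.sum_nonneg fun y _ => hnn _] at hsum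
    have hsum := congrFun hsum q
    rw [Pi.zero_apply, Fintype.sum_eq_zero_iff_of_nonneg fun x =>
      Finset.sum_nonneg fun y _ => hnn _] at hsum
    have hsum := congrFun hsum x
    rw [Pi.zero_apply, Fintype.sum_eq_zero_iff_of_nonneg fun y => hnn _] at hsum
    have hsum := congrFun hsum y
    simpa using hsum
  ext x y
  -- For `p = q = y` the sum is `C x y` times the order of the stabilizer of `y`.
  have h1 := hzero x y y y
  have h2 : ∀ π : Equiv.Perm (Fin k), C x (y ∘ π) * (if y ∘ π = y then 1 else 0)
      = C x y * (if y ∘ π = y then 1 else 0) := by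
    intro π
    split_ifs with hπ
    · rw [hπ]
    · simp
  simp only [h, h2, ← Finset.mul_sum] at h1
  refine (mul_eq_zero.1 h1).resolve_right ?_
  rw [Finset.sum_boole, ← Ne.eq_def, Nat.cast_ne_zero, ← Nat.pos_iff_ne_zero, Finset.card_pos]
  exact ⟨1, by simp⟩

/-- Schur–Weyl duality: the commutant of the tensor powers of unitaries is spanned by the permutation
operators. -/
theorem IsUnitaryInvariant.mem_span_permOp {d k : ℕ} {B : TensorMat d k}
    (hB : IsUnitaryInvariant B) : B ∈ Submodule.span ℂ (Set.range (permOp d (k := k))) := by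
  let E := EuclideanSpace ℂ ((Fin k → Fin d) × (Fin k → Fin d))
  let e : TensorMat d k →ₗ[ℂ] E :=
    { toFun := fun M => WithLp.toLp 2 fun z => M z.1 z.2
      map_add' := fun _ _ => rfl
      map_smul' := fun _ _ => rfl }
  let K : Submodule ℂ E := (Submodule.span ℂ (Set.range (permOp d (k := k)))).map e
  obtain ⟨y, hy, z, hz, hyz⟩ := K.exists_add_mem_mem_orthogonal (e B)
  obtain ⟨P, hP, rfl⟩ := hy
  have hz' : e (B - P) = z := by rw [map_sub, hyz, add_sub_cancel_left]
  suffices B - P = 0 by rwa [sub_eq_zero.1 this]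
  have hPc : CommutesWithSymmetrized P := by
    clear hyz hz'
    induction hP using Submodule.span_induction with
    | mem M hM => obtain ⟨σ, rfl⟩ := hM; exact permOp_commutesWithSymmetrized σ
    | zero => exact fun x y p q => by simp
    | add M N _ _ hM hN => exact hM.add hN
    | smul c M _ hM => exact hM.smul c
  refine (hB.commutesWithSymmetrized.sub hPc).eq_zero fun σ => ?_
  have horth := hz (e (permOp d σ⁻¹)) ⟨_, Submodule.subset_span ⟨_, rfl⟩, rfl⟩
  rw [← hz', PiLp.inner_apply, Fintype.sum_prod_type] at horth
  have hσ : ∀ x y : Fin k → Fin d, x = y ∘ ⇑σ⁻¹ ↔ y = x ∘ σ := fun x y => by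
    constructor <;> rintro rfl <;> ext s <;> simp
  have he : ∀ (M : TensorMat d k) x y, (e M).ofLp (x, y) = M x y := fun _ _ _ => rfl
  simpa only [he, permOp, hσ, Matrix.of_apply, RCLike.inner_apply, apply_ite (starRingEnd ℂ),
    map_one, map_zero, mul_ite, mul_one, mul_zero, Finset.sum_ite_eq', Finset.mem_univ,
    if_true] using horth

/-! ### Permutation operators induce trace monomials -/

theorem sum_option {β : Type*} [Fintype β] [DecidableEq β] [DecidableEq (Option β)]
    {d : ℕ} (F : (Option β → Fin d) → ℂ) :
    ∑ x, F x = ∑ y : β → Fin d, ∑ c, F fun o => o.elim c y := by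
  rw [Finset.sum_comm, ← Fintype.sum_prod_type', ← Equiv.piOptionEquivProd.symm.sum_comp]
  refine Finset.sum_congr rfl fun z _ => congrArg F ?_
  ext o
  cases o <;> rfl

/-- Contracting the indices of matrix words along a permutation gives a product of traces of words,
one for each cycle, in which every letter is used as often as before. The induction removes one
point of the permutation: a fixed point splits off a trace, any other point has its word appended
to the word of its preimage. -/
theorem exists_traces_of_perm {Λ : Type*} (γ : Type) [Finite γ] :
    ∀ [Fintype γ] [DecidableEq γ] (π : Equiv.Perm γ) (w : γ → List Λ),
      ∃ T : Multiset (List Λ),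
        (T.map Multiset.ofList).sum = ∑ s, (w s : Multiset Λ) ∧
        ∀ (d : ℕ) (A : Λ → Mat d),
          ∑ x : γ → Fin d, ∏ s, ((w s).map A).prod (x s) (x (π s))
            = (T.map fun l => ((l.map A).prod).trace).prod := by
  classical
  induction γ using Finite.induction_empty_option with
  | @of_equiv α β e ih =>
    intro _ _ π w
    have : Fintype α := Fintype.ofEquiv β e.symm
    obtain ⟨T, hT, hA⟩ := ih (e.permCongr.symm π) (w ∘ e)
    refine ⟨T, hT.trans (e.sum_comp fun s => (w s : Multiset Λ)), fun d A => ?_⟩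
    rw [← hA d A, ← (e.arrowCongr (Equiv.refl (Fin d))).sum_comp]
    refine Finset.sum_congr rfl fun x _ => ?_
    rw [← e.prod_comp]
    simp
  | h_empty =>
    intro _ _ π w
    exact ⟨0, by simp, fun d A => by simp⟩
  | @h_option β _ ih =>
    intro i _ π w
    obtain rfl : i = instFintypeOption := Subsingleton.elim _ _
    cases hn : π none with
    | none =>
      have hs : ∀ b, π (some b) = some (Equiv.removeNone π b) := fun b => by
        refine (Equiv.removeNone_some π (Option.ne_none_iff_exists'.1 fun h => ?_)).symm
        simpa using π.injective (h.trans hn.symm)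
      obtain ⟨T, hT, hA⟩ := ih (Equiv.removeNone π) fun b => w (some b)
      refine ⟨w none ::ₘ T, by simp [hT, Fintype.sum_option], fun d A => ?_⟩
      rw [Multiset.map_cons, Multiset.prod_cons, ← hA d A, sum_option]
      simp only [Fintype.prod_option, hn, hs, Option.elim, Matrix.trace, Matrix.diag,
        Finset.sum_mul, Finset.mul_sum]
    | some t =>
      obtain ⟨u, hu⟩ : ∃ u, π (some u) = none := by
        obtain ⟨o, ho⟩ := π.surjective none
        cases o with
        | none => simp [hn] at ho
        | some u => exact ⟨u, ho⟩
      have ht : Equiv.removeNone π u = t := by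
        simpa [hn] using Equiv.removeNone_none π hu
      have hs : ∀ b, b ≠ u → π (some b) = some (Equiv.removeNone π b) := fun b hb => by
        refine (Equiv.removeNone_some π (Option.ne_none_iff_exists'.1 fun h => hb ?_)).symm
        simpa using π.injective (h.trans hu.symm)
      obtain ⟨T, hT, hA⟩ := ih (Equiv.removeNone π)
        (Function.update (fun b => w (some b)) u (w (some u) ++ w none))
      refine ⟨T, hT.trans ?_, fun d A => ?_⟩
      · rw [Fintype.sum_option, ← Finset.add_sum_erase _ _ (Finset.mem_univ u),
          ← Finset.add_sum_erase (a := u) _ (fun b => (w (some b) : Multiset Λ))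
            (Finset.mem_univ u), Function.update_self, ← Multiset.coe_add, ← add_assoc,
          add_comm (w none : Multiset Λ)]
        congr 1
        refine Finset.sum_congr rfl fun b hb => ?_
        rw [Function.update_of_ne (Finset.ne_of_mem_erase hb)]
      · rw [← hA d A, sum_option]
        refine Finset.sum_congr rfl fun x _ => ?_
        rw [← Finset.mul_prod_erase _ _ (Finset.mem_univ u), Function.update_self, ht,
          List.map_append, List.prod_append, Matrix.mul_apply, Finset.sum_mul]
        refine Finset.sum_congr rfl fun c _ => ?_
        rw [Fintype.prod_option, hn, ← Finset.mul_prod_erase _ _ (Finset.mem_univ u), hu,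
          ← mul_assoc]
        simp only [Option.elim]
        rw [mul_comm ((List.map A (w none)).prod c (x t))]
        congr 1
        refine Finset.prod_congr rfl fun b hb => ?_
        rw [hs b (Finset.ne_of_mem_erase hb), Function.update_of_ne (Finset.ne_of_mem_erase hb)]

theorem trace_permOp_mul_tensorProd {d k : ℕ} (σ : Equiv.Perm (Fin k)) (A : Fin k → Mat d) :
    (permOp d σ * tensorProd A).trace = ∑ x : Fin k → Fin d, ∏ s, A s (x s) (x (σ s)) := by
  simp only [Matrix.trace, Matrix.diag, Matrix.mul_apply, permOp, tensorProd, Matrix.of_apply]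
  rw [Finset.sum_comm]
  simp

theorem map_prod_reduceOption {M Λ : Type*} [Monoid M] (A : Option Λ → M) (l : List (Option Λ))
    (hl : none ∉ l) : (l.reduceOption.map fun i => A (some i)).prod = (l.map A).prod := by
  induction l with
  | nil => rfl
  | cons o l ih =>
    cases o with
    | none => simp at hl
    | some i =>
      simp only [List.mem_cons, not_or] at hl
      simp [List.reduceOption_cons_of_some, ih hl.2]

theorem filterMap_sum_map_ofList {Λ : Type*} (T : Multiset (List (Option Λ))) :
    Multiset.filterMap id (T.map Multiset.ofList).sum
      = ((T.map List.reduceOption).map Multiset.ofList).sum := by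
  induction T using Multiset.induction with
  | empty => rfl
  | cons l T ih =>
    simp only [Multiset.map_cons, Multiset.sum_cons, Multiset.filterMap_add, ih]
    rfl

theorem TraceMonomial.letters_eq {r : ℕ} (m : TraceMonomial r) :
    m.letters = (m.word : Multiset (Fin r)) + (m.traces.map Multiset.ofList).sum := by
  simp [TraceMonomial.letters, Multiset.bind_def, Multiset.pure_def, Multiset.bind_singleton]

/-- `f_B` for a permutation operator `B` is a multilinear trace monomial. The word of the cycle
through the last tensor factor, cut open at that factor, is the matrix part of the monomial; the
other cycles are its traces. -/
theorem exists_traceMonomial_permOp {r : ℕ} (σ : Equiv.Perm (Fin (r + 1))) :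
    ∃ m : TraceMonomial r, m.letters = (Finset.univ : Finset (Fin r)).val ∧
      ∀ d, inducedMap (permOp d σ) = m.eval := by
  obtain ⟨T, hT, hA⟩ := exists_traces_of_perm (Λ := Option (Fin r)) (Fin (r + 1)) σ
    fun s => [finSuccEquivLast s]
  have hT' : (T.map Multiset.ofList).sum
      = none ::ₘ (Finset.univ : Finset (Fin r)).val.map some := by
    rw [hT, Fin.sum_univ_castSucc, add_comm]
    simp only [finSuccEquivLast_last, finSuccEquivLast_castSucc, Multiset.coe_singleton]
    rw [Multiset.singleton_add]
    refine congrArg _ ?_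
    rw [← Multiset.sum_map_singleton ((Finset.univ : Finset (Fin r)).val.map some),
      Multiset.map_map]
    rfl
  -- The word through the last tensor factor, whose letter is `none`.
  obtain ⟨τ, hτ, hnone⟩ : ∃ τ ∈ T, none ∈ τ := by
    have h : none ∈ (T.map Multiset.ofList).join := by
      rw [Multiset.join, hT']
      exact Multiset.mem_cons_self _ _
    simpa [Multiset.mem_join] using h
  obtain ⟨T', rfl⟩ := Multiset.exists_cons_of_mem hτ
  obtain ⟨u, v, rfl⟩ := List.append_of_mem hnone
  have hletters : Multiset.ofList (v ++ u) + (T'.map Multiset.ofList).sum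
      = (Finset.univ : Finset (Fin r)).val.map some := by
    refine (Multiset.cons_inj_right none).1 (hT' ▸ ?_)
    rw [Multiset.map_cons, Multiset.sum_cons, ← Multiset.cons_add, Multiset.cons_coe]
    refine congrArg (· + _) (Multiset.coe_eq_coe.2 ?_)
    exact (List.perm_append_comm (l₁ := none :: v) (l₂ := u))
  have hno : none ∉ Multiset.ofList (v ++ u) + (T'.map Multiset.ofList).sum := by
    simp [hletters]
  rw [Multiset.mem_add, not_or] at hno
  have hvu : none ∉ v ++ u := hno.1
  have hT'' : ∀ l ∈ T', none ∉ l := fun l hl h =>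
    hno.2 (Multiset.mem_join.2 ⟨_, Multiset.mem_map_of_mem _ hl, h⟩)
  refine ⟨⟨(v ++ u).reduceOption, T'.map List.reduceOption⟩, ?_, fun d => ?_⟩
  · have := congrArg (Multiset.filterMap id) hletters
    rw [Multiset.filterMap_add, filterMap_sum_map_ofList, Multiset.filterMap_map] at this
    rw [TraceMonomial.letters_eq]
    exact this.trans (Multiset.filterMap_some _)
  · funext X
    refine Matrix.ext_iff_trace_mul_right.2 fun Y => ?_
    rw [trace_inducedMap_mul, trace_permOp_mul_tensorProd]
    have h := hA d fun o => o.elim Y X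
    have hsnoc : ∀ s, Fin.snoc (α := fun _ => Mat d) X Y s
        = (finSuccEquivLast s).elim Y X := fun s => by
      refine Fin.lastCases ?_ (fun s => ?_) s <;> simp
    simp only [List.map_cons, List.map_nil, List.prod_cons, List.prod_nil, mul_one,
      ← hsnoc] at h
    rw [h, Multiset.map_cons, Multiset.prod_cons, TraceMonomial.eval, Matrix.smul_mul,
      Matrix.trace_smul, smul_eq_mul, mul_comm, Multiset.map_map]
    congr 1
    · refine congrArg _ (Multiset.map_congr rfl fun l hl => ?_)
      rw [Function.comp_apply, ← map_prod_reduceOption _ l (hT'' l hl)]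
      rfl
    · have := map_prod_reduceOption (fun o : Option (Fin r) => o.elim Y X) _ hvu
      change _ = Matrix.trace ((List.map (fun i => X i) (v ++ u).reduceOption).prod * Y)
      refine Eq.trans ?_ (congrArg (fun M => Matrix.trace (M * Y)) this).symm
      simp only [List.map_append, List.prod_append, List.map_cons, List.prod_cons]
      rw [Matrix.trace_mul_comm, mul_assoc, Matrix.trace_mul_comm]
      rfl

/-! ### Multilinear trace polynomials are exactly the maps induced by invariant operators -/

theorem TracePolynomial.eval_add {r d : ℕ} (p q : TracePolynomial r) :
    (p + q).eval d = p.eval d + q.eval d := by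
  funext X
  exact Finsupp.sum_add_index' (fun m => zero_smul ℂ _) fun m b c => add_smul b c _

theorem TracePolynomial.eval_smul {r d : ℕ} (c : ℂ) (p : TracePolynomial r) :
    (c • p).eval d = c • p.eval d := by
  funext X
  refine (Finsupp.sum_smul_index' (h := fun (m : TraceMonomial r) (b : ℂ) => b • m.eval X)
    fun m => zero_smul ℂ _).trans ?_
  simp only [TracePolynomial.eval, Pi.smul_apply, Finsupp.smul_sum, smul_assoc]

theorem inducedMap_add {d r : ℕ} (B C : TensorMat d (r + 1)) :
    inducedMap (B + C) = inducedMap B + inducedMap C := by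
  funext X
  ext a b
  simp [inducedMap_apply, add_mul, Finset.sum_add_distrib]

theorem inducedMap_smul {d r : ℕ} (c : ℂ) (B : TensorMat d (r + 1)) :
    inducedMap (c • B) = c • inducedMap B := by
  funext X
  ext a b
  simp [inducedMap_apply, mul_assoc, Finset.mul_sum]

theorem IsUnitaryInvariant.exists_tracePolynomial {d r : ℕ} {B : TensorMat d (r + 1)}
    (hB : IsUnitaryInvariant B) :
    ∃ p : TracePolynomial r, p.IsMultilinear ∧ inducedMap B = p.eval d := by
  have hspan := hB.mem_span_permOp
  clear hB
  induction hspan using Submodule.span_induction with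
  | mem M hM =>
    obtain ⟨σ, rfl⟩ := hM
    obtain ⟨m, hm, he⟩ := exists_traceMonomial_permOp σ
    refine ⟨Finsupp.single m 1, fun n hn => ?_, ?_⟩
    · rw [Finset.mem_singleton.1 (Finsupp.support_single_subset hn), hm]
    · funext X
      rw [he d]
      exact ((Finsupp.sum_single_index (h := fun (m : TraceMonomial r) (b : ℂ) => b • m.eval X)
        (zero_smul ℂ _)).trans (one_smul ℂ _)).symm
  | zero =>
    refine ⟨0, fun n hn => by simp at hn, ?_⟩
    funext X
    ext a b
    simp [inducedMap_apply, TracePolynomial.eval]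
  | add M N _ _ hM hN =>
    obtain ⟨p, hp, hp'⟩ := hM
    obtain ⟨q, hq, hq'⟩ := hN
    classical
    refine ⟨p + q, fun m hm => ?_, ?_⟩
    · exact (Finset.mem_union.1 (Finsupp.support_add hm)).elim (hp m) (hq m)
    · rw [inducedMap_add, hp', hq', TracePolynomial.eval_add]
  | smul c M _ hM =>
    obtain ⟨p, hp, hp'⟩ := hM
    refine ⟨c • p, fun m hm => hp m (Finsupp.support_smul hm), ?_⟩
    rw [inducedMap_smul, hp', TracePolynomial.eval_smul]

theorem prod_map_update_of_notMem {d r : ℕ} (X : Fin r → Mat d) (i : Fin r) (Y : Mat d)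
    {w : List (Fin r)} (hw : i ∉ w) :
    (w.map (Function.update X i Y)).prod = (w.map X).prod := by
  congr 1
  exact List.map_congr_left fun j hj => Function.update_of_ne (ne_of_mem_of_not_mem hj hw) _ _

/-- A word in which a variable occurs exactly once is linear in this variable. -/
theorem isLinearMap_word {d r : ℕ} (X : Fin r → Mat d) (i : Fin r) (w : List (Fin r))
    (hw : w.count i = 1) :
    IsLinearMap ℂ fun Y => (w.map (Function.update X i Y)).prod := by
  obtain ⟨u, v, rfl⟩ := List.append_of_mem (List.count_pos_iff.1 (hw ▸ Nat.one_pos))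
  have hc : u.count i = 0 ∧ v.count i = 0 := by
    simp only [List.count_append, List.count_cons_self] at hw
    omega
  have hu := List.count_eq_zero.1 hc.1
  have hv := List.count_eq_zero.1 hc.2
  simp only [List.map_append, List.map_cons, List.prod_append, List.prod_cons,
    prod_map_update_of_notMem X i _ hu, prod_map_update_of_notMem X i _ hv, Function.update_self]
  exact ⟨fun Y Z => by simp only [add_mul, mul_add],
    fun c Y => by simp only [smul_mul_assoc, mul_smul_comm]⟩

theorem traces_update_of_notMem {d r : ℕ} (X : Fin r → Mat d) (i : Fin r) (Y : Mat d)
    {T : Multiset (List (Fin r))} (hT : ∀ w ∈ T, i ∉ w) :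
    (T.map fun w => ((w.map (Function.update X i Y)).prod).trace)
      = T.map fun w => ((w.map X).prod).trace :=
  Multiset.map_congr rfl fun w hw => by rw [prod_map_update_of_notMem X i Y (hT w hw)]

/-- A multilinear monomial is linear in each variable: the variable occurs either once in the matrix
word or once in exactly one of the traces. -/
theorem isLinearMap_eval_update {d r : ℕ} {m : TraceMonomial r}
    (hm : m.letters = (Finset.univ : Finset (Fin r)).val) (X : Fin r → Mat d) (i : Fin r) :
    IsLinearMap ℂ fun Y => m.eval (Function.update X i Y) := by
  rw [TraceMonomial.letters_eq] at hm
  have hcount : (m.word).count i + (m.traces.map Multiset.ofList).sum.count i = 1 := by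
    rw [← Multiset.coe_count, ← Multiset.count_add, hm]
    exact Multiset.count_eq_one_of_mem Finset.univ.nodup (Finset.mem_univ i)
  have hno : ∀ T : Multiset (List (Fin r)), (T.map Multiset.ofList).sum.count i = 0 →
      ∀ w ∈ T, i ∉ w := fun T hT w hw h =>
    Multiset.count_eq_zero.1 hT (Multiset.mem_join.2 ⟨_, Multiset.mem_map_of_mem _ hw, h⟩)
  by_cases hw : m.word.count i = 1
  · have hT := hno m.traces (by omega)
    have hlin := isLinearMap_word X i m.word hw
    simp only [TraceMonomial.eval, traces_update_of_notMem X i _ hT]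
    exact ⟨fun Y Z => by rw [hlin.map_add, smul_add],
      fun c Y => by rw [hlin.map_smul, smul_comm]⟩
  · have hw0 : m.word.count i = 0 := by omega
    have hmem : i ∈ (m.traces.map Multiset.ofList).join :=
      Multiset.count_pos.1 (show 0 < (m.traces.map Multiset.ofList).sum.count i by omega)
    obtain ⟨w, hwT, hiw⟩ : ∃ w ∈ m.traces, i ∈ w := by simpa [Multiset.mem_join] using hmem
    obtain ⟨T, hT⟩ := Multiset.exists_cons_of_mem hwT
    have hc : w.count i + (T.map Multiset.ofList).sum.count i = 1 := by
      rw [hT, Multiset.map_cons, Multiset.sum_cons, Multiset.count_add, Multiset.coe_count]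
        at hcount
      omega
    have hpos := List.count_pos_iff.2 hiw
    have hlin := isLinearMap_word X i w (by omega)
    simp only [TraceMonomial.eval, hT, Multiset.map_cons, Multiset.prod_cons,
      traces_update_of_notMem X i _ (hno T (by omega)),
      prod_map_update_of_notMem X i _ (List.count_eq_zero.1 hw0)]
    exact ⟨fun Y Z => by rw [hlin.map_add, Matrix.trace_add, add_mul, add_smul],
      fun c Y => by rw [hlin.map_smul, Matrix.trace_smul, smul_mul_assoc, smul_assoc]⟩

theorem TracePolynomial.IsMultilinear.exists_inducedMap_eq {d r : ℕ} {p : TracePolynomial r}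
    (hp : p.IsMultilinear) : ∃ B : TensorMat d (r + 1), inducedMap B = p.eval d := by
  refine _root_.exists_inducedMap_eq (MultilinearMap.mk' (p.eval d) (fun X i Y Z => ?_)
    fun X i c Y => ?_)
  · simp only [TracePolynomial.eval, Finsupp.sum, ← Finset.sum_add_distrib, ← smul_add]
    exact Finset.sum_congr rfl fun m hm =>
      congrArg _ ((isLinearMap_eval_update (hp m hm) X i).map_add Y Z)
  · simp only [TracePolynomial.eval, Finsupp.sum, Finset.smul_sum, smul_comm c]
    exact Finset.sum_congr rfl fun m hm =>
      congrArg _ ((isLinearMap_eval_update (hp m hm) X i).map_smul c Y)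

/-- Trace polynomials are equivariant under simultaneous unitary conjugation. -/
theorem TracePolynomial.eval_conj {d r : ℕ} (p : TracePolynomial r) {U : Mat d}
    (hU : U ∈ Matrix.unitaryGroup (Fin d) ℂ) (X : Fin r → Mat d) :
    p.eval d (fun i => U * X i * Uᴴ) = U * p.eval d X * Uᴴ := by
  have hU' : Uᴴ * U = 1 := Matrix.mem_unitaryGroup_iff'.1 hU
  have hU'' : U * Uᴴ = 1 := Matrix.mem_unitaryGroup_iff.1 hU
  have hword : ∀ w : List (Fin r),
      (w.map fun i => U * X i * Uᴴ).prod = U * (w.map X).prod * Uᴴ := by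
    intro w
    induction w with
    | nil => simp [hU'']
    | cons i w ih =>
      simp only [List.map_cons, List.prod_cons, ih]
      calc U * X i * Uᴴ * (U * (w.map X).prod * Uᴴ)
          = U * X i * (Uᴴ * U) * (w.map X).prod * Uᴴ := by simp only [mul_assoc]
        _ = _ := by rw [hU', mul_one]; simp only [mul_assoc]
  have htr : ∀ M : Mat d, (U * M * Uᴴ).trace = M.trace := fun M => by
    rw [Matrix.trace_mul_comm, ← mul_assoc, hU', one_mul]
  simp only [TracePolynomial.eval, Finsupp.sum, TraceMonomial.eval, hword, htr, Finset.mul_sum,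
    Finset.sum_mul, mul_smul_comm, smul_mul_assoc]

/-- An operator inducing a trace polynomial is unitarily invariant, by equivariance of the
polynomial and nondegeneracy of the trace pairing. -/
theorem isUnitaryInvariant_of_eval {d r : ℕ} {B : TensorMat d (r + 1)} {p : TracePolynomial r}
    (h : inducedMap B = p.eval d) : IsUnitaryInvariant B := by
  refine isUnitaryInvariant_of_commute fun U hU => ?_
  have hU' : Uᴴ * U = 1 := Matrix.mem_unitaryGroup_iff'.1 hU
  have hU'' : U * Uᴴ = 1 := Matrix.mem_unitaryGroup_iff.1 hU
  have key : tensorProd (fun _ => Uᴴ) * B * tensorProd (fun _ => U) = B := by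
    refine eq_of_trace_mul_tensorProd fun A => ?_
    rw [mul_assoc, mul_assoc, Matrix.trace_mul_comm, mul_assoc, mul_assoc, tensorProd_mul,
      tensorProd_mul, ← Fin.snoc_init_self A, ← trace_inducedMap_mul]
    have hs : (fun s => U * (Fin.snoc (α := fun _ => Mat d) (Fin.init A) (A (Fin.last r)) s * Uᴴ))
        = Fin.snoc (α := fun _ => Mat d) (fun i => U * Fin.init A i * Uᴴ)
          (U * A (Fin.last r) * Uᴴ) := by
      funext s
      refine Fin.lastCases ?_ (fun s => ?_) s <;> simp [mul_assoc]
    rw [hs, ← trace_inducedMap_mul, h, p.eval_conj hU]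
    calc (U * p.eval d (Fin.init A) * Uᴴ * (U * A (Fin.last r) * Uᴴ)).trace
        = (U * (p.eval d (Fin.init A) * (Uᴴ * U) * A (Fin.last r) * Uᴴ)).trace := by
          simp only [mul_assoc]
      _ = _ := by rw [Matrix.trace_mul_comm, hU', mul_one, mul_assoc, hU', mul_one]
  calc B * tensorProd (fun _ => U)
      = tensorProd (fun _ => U) * tensorProd (fun _ => Uᴴ) * (B * tensorProd fun _ => U) := by
        rw [tensorProd_mul, hU'', tensorProd_one, one_mul]
    _ = tensorProd (fun _ => U) * (tensorProd (fun _ => Uᴴ) * B * tensorProd fun _ => U) := by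
        simp only [mul_assoc]
    _ = tensorProd (fun _ => U) * B := by rw [key]

/-! ### Block-positivity and positivity of the induced map -/

section
open scoped MatrixOrder

theorem Matrix.PosSemidef.exists_eq_conjTranspose_mul_self {n : Type*} [Fintype n]
    {A : Matrix n n ℂ} (hA : A.PosSemidef) : ∃ C : Matrix n n ℂ, A = Cᴴ * C := by
  classical
  exact CStarAlgebra.nonneg_iff_eq_star_mul_self.1 (Matrix.nonneg_iff_posSemidef.2 hA)

theorem spectrum_nonneg_of_posSemidef {n : Type*} [Fintype n] [DecidableEq n]
    {A : Matrix n n ℂ} (hA : A.PosSemidef) {t : ℝ} (ht : t ∈ spectrum ℝ A) : 0 ≤ t :=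
  spectrum_nonneg_of_nonneg (Matrix.nonneg_iff_posSemidef.2 hA) ht

end

theorem trace_mul_nonneg_of_posSemidef {n : Type*} [Fintype n] {A S : Matrix n n ℂ}
    (hA : A.PosSemidef) (hS : S.PosSemidef) : 0 ≤ (A * S).trace := by
  classical
  obtain ⟨C, rfl⟩ := hS.exists_eq_conjTranspose_mul_self
  rw [← mul_assoc, Matrix.trace_mul_comm, ← mul_assoc]
  exact (hA.mul_mul_conjTranspose_same C).trace_nonneg

/-- If `tr [A S] = 0` for positive semidefinite `A` and `S`, then `A S = 0`. -/
theorem mul_eq_zero_of_trace_mul_eq_zero {n : Type*} [Fintype n] {A S : Matrix n n ℂ}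
    (hA : A.PosSemidef) (hS : S.PosSemidef) (h : (A * S).trace = 0) : A * S = 0 := by
  classical
  obtain ⟨D, rfl⟩ := hA.exists_eq_conjTranspose_mul_self
  obtain ⟨C, rfl⟩ := hS.exists_eq_conjTranspose_mul_self
  have h1 : (D * Cᴴ)ᴴ * (D * Cᴴ) = C * (Dᴴ * D) * Cᴴ := by
    simp [Matrix.conjTranspose_mul, mul_assoc]
  have h2 : D * Cᴴ = 0 := by
    rw [← Matrix.trace_conjTranspose_mul_self_eq_zero_iff, h1, mul_assoc,
      Matrix.trace_mul_comm, mul_assoc, h]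
  calc Dᴴ * D * (Cᴴ * C) = Dᴴ * (D * Cᴴ) * C := by simp only [mul_assoc]
    _ = 0 := by rw [h2, mul_zero, zero_mul]

theorem IsState.smul_of_posSemidef {n : Type*} [Fintype n] {A : Matrix n n ℂ}
    (hA : A.PosSemidef) (h0 : A ≠ 0) : IsState (A.trace⁻¹ • A) := by
  have ht : A.trace ≠ 0 := fun h => h0 (hA.trace_eq_zero_iff.1 h)
  refine ⟨hA.smul (inv_nonneg.2 hA.trace_nonneg), ?_⟩
  rw [Matrix.trace_smul, smul_eq_mul, inv_mul_cancel₀ ht]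

/-- For block-positivity it suffices to test products of positive semidefinite matrices. -/
theorem isBlockPositive_iff {d k : ℕ} {B : TensorMat d k} :
    IsBlockPositive B ↔
      ∀ A : Fin k → Mat d, (∀ s, (A s).PosSemidef) → 0 ≤ (B * tensorProd A).trace := by
  constructor
  · intro hB A hA
    by_cases h0 : ∃ s, A s = 0
    · obtain ⟨s, hs⟩ := h0
      have : tensorProd A = 0 := (tensorProdMultilinear d k).map_coord_zero s hs
      simp [this]
    · push Not at h0
      have hst : 0 ≤ (B * tensorProd fun s => (A s).trace⁻¹ • A s).trace :=
        hB _ (subset_convexHull ℝ _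
          ⟨_, fun s => IsState.smul_of_posSemidef (hA s) (h0 s), rfl⟩)
      have hA' : A = fun s => (A s).trace • (A s).trace⁻¹ • A s := by
        funext s
        rw [smul_inv_smul₀ fun h => h0 s ((hA s).trace_eq_zero_iff.1 h)]
      rw [hA', tensorProd_smul, mul_smul_comm, Matrix.trace_smul, smul_eq_mul]
      exact mul_nonneg (Finset.prod_nonneg fun s _ => (hA s).trace_nonneg) hst
  · intro hB ρ hρ
    have hconv : Convex ℝ {ρ : TensorMat d k | 0 ≤ (B * ρ).trace} :=
      (convex_Ici (0 : ℂ)).linear_preimage ((traceForm B).restrictScalars ℝ)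
    refine convexHull_min ?_ hconv hρ
    rintro τ ⟨σ, hσ, rfl⟩
    exact hB σ fun s => (hσ s).1

/-- A block-positive operator pairing to zero with a separable state pairs to zero with a product
state, since `{ρ | 0 < tr [B ρ]}` is convex. -/
theorem IsBlockPositive.vanishesOnSeparable_iff {d k : ℕ} {B : TensorMat d k}
    (hB : IsBlockPositive B) :
    VanishesOnSeparable B ↔
      ∃ σ : Fin k → Mat d, (∀ s, IsState (σ s)) ∧ (B * tensorProd σ).trace = 0 := by
  constructor
  · rintro ⟨ρ, hρ, h0⟩
    by_contra! hne
    have hconv : Convex ℝ {ρ : TensorMat d k | 0 < (B * ρ).trace} :=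
      (convex_Ioi (0 : ℂ)).linear_preimage ((traceForm B).restrictScalars ℝ)
    have hpos : 0 < (B * ρ).trace := by
      refine convexHull_min ?_ hconv hρ
      rintro τ ⟨σ, hσ, rfl⟩
      exact lt_of_le_of_ne (hB _ (subset_convexHull ℝ _ ⟨σ, hσ, rfl⟩)) (hne σ hσ).symm
    exact hpos.ne' h0
  · rintro ⟨σ, hσ, h0⟩
    exact ⟨_, subset_convexHull ℝ _ ⟨σ, hσ, rfl⟩, h0⟩

theorem snoc_posSemidef {d r : ℕ} {X : Fin r → Mat d} {Y : Mat d} (hX : ∀ i, (X i).PosSemidef)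
    (hY : Y.PosSemidef) (s : Fin (r + 1)) :
    (Fin.snoc (α := fun _ => Mat d) X Y s).PosSemidef := by
  refine Fin.lastCases ?_ (fun s => ?_) s <;> simp [hX, hY]

theorem trace_mul_vecMulVec_star {n : Type*} [Fintype n] (A : Matrix n n ℂ) (v : n → ℂ) :
    (A * Matrix.vecMulVec v (star v)).trace = star v ⬝ᵥ A *ᵥ v := by
  rw [Matrix.mul_vecMulVec, Matrix.trace_vecMulVec, dotProduct_comm]

/-- Over `ℂ`, nonnegativity of the quadratic form already forces the matrix to be Hermitian. -/
theorem posSemidef_of_forall_dotProduct_nonneg {n : Type*} [Fintype n] {A : Matrix n n ℂ}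
    (h : ∀ v : n → ℂ, 0 ≤ star v ⬝ᵥ A *ᵥ v) : A.PosSemidef := by
  classical
  rw [← Matrix.isPositive_toEuclideanLin_iff, LinearMap.isPositive_iff_complex]
  intro x
  have hx := h x.ofLp
  have hin : inner ℂ (Matrix.toEuclideanLin A x) x = star (star x.ofLp ⬝ᵥ A *ᵥ x.ofLp) := by
    rw [EuclideanSpace.inner_eq_star_dotProduct, ← Matrix.star_dotProduct_star, star_star,
      dotProduct_comm]
    simp [Matrix.ofLp_toLpLin]
  rw [hin, (IsSelfAdjoint.of_nonneg hx).star_eq]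
  exact ⟨RCLike.conj_eq_iff_re.1 (IsSelfAdjoint.of_nonneg hx).star_eq, (RCLike.nonneg_iff.1 hx).1⟩

/-- `B` is block-positive exactly when `f_B` is an inequality on the positive cone, because
`⟨v, f_B (X) v⟩ = tr [B (X_1 ⊗ ⋯ ⊗ X_r ⊗ v v^†)]`. -/
theorem isBlockPositive_iff_inducedMap {d r : ℕ} {B : TensorMat d (r + 1)} :
    IsBlockPositive B ↔
      ∀ X : Fin r → Mat d, (∀ i, (X i).PosSemidef) → (inducedMap B X).PosSemidef := by
  rw [isBlockPositive_iff]
  constructor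
  · intro hB X hX
    refine posSemidef_of_forall_dotProduct_nonneg fun v => ?_
    rw [← trace_mul_vecMulVec_star, trace_inducedMap_mul]
    exact hB _ (snoc_posSemidef hX (Matrix.posSemidef_vecMulVec_self_star v))
  · intro hB A hA
    rw [← Fin.snoc_init_self A, ← trace_inducedMap_mul]
    exact trace_mul_nonneg_of_posSemidef (hB _ fun i => hA _) (hA _)

theorem isTraceInequality_inducedMap_iff {d r : ℕ} {B : TensorMat d (r + 1)} :
    IsTraceInequality (inducedMap B) ↔ IsUnitaryInvariant B ∧ IsBlockPositive B := by
  rw [isBlockPositive_iff_inducedMap]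
  exact and_congr_left fun _ =>
    ⟨fun ⟨_, _, h⟩ => isUnitaryInvariant_of_eval h, fun h => h.exists_tracePolynomial⟩

theorem bijOn_inducedMap (d r : ℕ) :
    Set.BijOn (fun B : TensorMat d (r + 1) => inducedMap B)
      {B | IsUnitaryInvariant B ∧ IsBlockPositive B}
      {f : (Fin r → Mat d) → Mat d | IsTraceInequality f} := by
  refine ⟨fun B hB => isTraceInequality_inducedMap_iff.2 hB, inducedMap_injective.injOn, ?_⟩
  intro f hf
  obtain ⟨p, hp, hfp⟩ := hf.1
  obtain ⟨B, hB⟩ := hp.exists_inducedMap_eq (d := d)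
  obtain rfl : f = inducedMap B := hfp.trans hB.symm
  exact ⟨B, isTraceInequality_inducedMap_iff.1 hf, rfl⟩

/-! ### Optimality -/

theorem isMinEigenvalue_zero_iff {d : ℕ} {A : Mat d} (hA : A.PosSemidef) :
    IsMinEigenvalue A 0 ↔ ∃ v : Fin d → ℂ, v ≠ 0 ∧ A *ᵥ v = 0 := by
  have hlb : (0 : ℝ) ∈ lowerBounds (spectrum ℝ A) := fun _ => spectrum_nonneg_of_posSemidef hA
  rw [IsMinEigenvalue, IsLeast, and_iff_left hlb, spectrum.zero_mem_iff,
    Matrix.isUnit_iff_isUnit_det, isUnit_iff_ne_zero, not_not, Matrix.exists_mulVec_eq_zero_iff]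

theorem isOptimalTraceInequality_inducedMap_iff {d r : ℕ} (B : TensorMat d (r + 1)) :
    IsOptimalTraceInequality (inducedMap B) ↔
      IsUnitaryInvariant B ∧ IsBlockPositive B ∧ VanishesOnSeparable B := by
  rw [IsOptimalTraceInequality, isTraceInequality_inducedMap_iff, and_assoc]
  refine and_congr_right fun hinv => and_congr_right fun hbp => ?_
  have hpos := isBlockPositive_iff_inducedMap.1 hbp
  rw [hbp.vanishesOnSeparable_iff]
  constructor
  · rintro ⟨X, hX, hmin⟩
    obtain ⟨v, hv, hAv⟩ := (isMinEigenvalue_zero_iff (hpos X fun i => (hX i).1)).1 hmin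
    have hvv : Matrix.vecMulVec v (star v) ≠ 0 := by
      simpa using hv
    let A : Fin (r + 1) → Mat d := Fin.snoc (α := fun _ => Mat d) X (Matrix.vecMulVec v (star v))
    have hA : ∀ s, (A s).PosSemidef :=
      snoc_posSemidef (fun i => (hX i).1) (Matrix.posSemidef_vecMulVec_self_star v)
    have hA0 : ∀ s, A s ≠ 0 := fun s => by
      refine Fin.lastCases ?_ (fun s => ?_) s
      · simpa [A] using hvv
      · simpa [A] using (hX s).2
    -- Normalizing the factors to states keeps the pairing with `B` equal to zero.
    refine ⟨fun s => (A s).trace⁻¹ • A s,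
      fun s => IsState.smul_of_posSemidef (hA s) (hA0 s), ?_⟩
    rw [tensorProd_smul, mul_smul_comm, Matrix.trace_smul, ← trace_inducedMap_mul,
      trace_mul_vecMulVec_star, hAv, dotProduct_zero, smul_zero]
  · rintro ⟨σ, hσ, h0⟩
    have hne : ∀ s, σ s ≠ 0 := fun s h => by simpa [h] using (hσ s).2
    have hP := hpos (Fin.init σ) fun i => (hσ _).1
    refine ⟨Fin.init σ, fun i => ⟨(hσ _).1, hne _⟩, (isMinEigenvalue_zero_iff hP).2 ?_⟩
    rw [← Fin.snoc_init_self σ, ← trace_inducedMap_mul] at h0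
    have hmul := mul_eq_zero_of_trace_mul_eq_zero hP (hσ _).1 h0
    -- Any nonzero column of the last factor lies in the kernel.
    obtain ⟨b, hb⟩ : ∃ b, (σ (Fin.last r)).col b ≠ 0 := by
      by_contra! h
      exact hne (Fin.last r) (Matrix.ext fun a b => congrFun (h b) a)
    exact ⟨_, hb, funext fun a => congrFun₂ hmul a b⟩

/-! ### Werner state witnesses -/

/-- The pairings of a block-positive operator with products of positive semidefinite matrices are
real, and these products span. -/
theorem IsBlockPositive.isHermitian {d k : ℕ} {B : TensorMat d k} (hB : IsBlockPositive B) :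
    B.IsHermitian := by
  rw [isBlockPositive_iff] at hB
  refine eq_of_trace_mul_tensorProd_posSemidef fun A hA => ?_
  have h1 : (tensorProd A)ᴴ = tensorProd A := by
    rw [tensorProd_conjTranspose]
    exact congrArg _ (funext fun s => (hA s).isHermitian)
  have h2 : star (B * tensorProd A).trace = (B * tensorProd A).trace :=
    (IsSelfAdjoint.of_nonneg (hB A hA)).star_eq
  rw [← h2, ← Matrix.trace_conjTranspose, Matrix.conjTranspose_mul, h1, Matrix.trace_mul_comm]

section
open scoped MatrixOrder

/-- A Hermitian matrix that is not positive semidefinite is detected by a state commuting with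
everything that commutes with the matrix, namely its normalized negative part. -/
theorem exists_state_trace_neg {n : Type*} [Fintype n] [DecidableEq n] {B : Matrix n n ℂ}
    (hB : B.IsHermitian) (hneg : ¬ B.PosSemidef) :
    ∃ σ : Matrix n n ℂ, IsState σ ∧ (B * σ).trace < 0 ∧ ∀ V, Commute B V → Commute σ V := by
  have hsa : IsSelfAdjoint B := hB
  let N : Matrix n n ℂ := cfc (fun x : ℝ => max (-x) 0) B
  have hN : N.PosSemidef := by
    rw [← Matrix.nonneg_iff_posSemidef]
    exact cfc_nonneg fun x _ => le_max_right _ _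
  have hBN : B * N = - (N * N) := by
    calc B * N = cfc (fun x : ℝ => x) B * N := by rw [cfc_id' ℝ B]
      _ = cfc (fun x : ℝ => -(max (-x) 0 * max (-x) 0)) B := by
        rw [← cfc_mul ..]
        refine cfc_congr fun x _ => ?_
        rcases le_total x 0 with hx | hx
        · simp [max_eq_left (neg_nonneg.2 hx)]
        · simp [max_eq_right (neg_nonpos.2 hx)]
      _ = - (N * N) := by rw [cfc_neg, cfc_mul ..]
  -- If the negative part vanishes, the matrix equals its positive part.
  have hN0 : N ≠ 0 := by
    intro h
    have hpos : 0 ≤ cfc (fun x : ℝ => max x 0) B := cfc_nonneg fun x _ => le_max_right _ _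
    have hB' : cfc (fun x : ℝ => max x 0) B - N = B := by
      rw [← cfc_sub ..]
      refine Eq.trans (cfc_congr fun x _ => ?_) (cfc_id' ℝ B)
      rcases le_total x 0 with hx | hx
      · simp [max_eq_left (neg_nonneg.2 hx), max_eq_right hx]
      · simp [max_eq_right (neg_nonpos.2 hx), max_eq_left hx]
    rw [h, sub_zero] at hB'
    exact hneg (Matrix.nonneg_iff_posSemidef.1 (hB' ▸ hpos))
  have ht : 0 < N.trace := lt_of_le_of_ne hN.trace_nonneg
    fun h => hN0 (hN.trace_eq_zero_iff.1 h.symm)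
  have hNN : 0 < (N * N).trace := by
    have h1 := trace_mul_nonneg_of_posSemidef hN hN
    refine lt_of_le_of_ne h1 fun h => hN0 ?_
    rw [← Matrix.trace_conjTranspose_mul_self_eq_zero_iff, hN.isHermitian, h]
  refine ⟨N.trace⁻¹ • N, IsState.smul_of_posSemidef hN hN0, ?_, fun V hV => ?_⟩
  · rw [mul_smul_comm, Matrix.trace_smul, hBN, Matrix.trace_neg, smul_eq_mul, mul_neg,
      neg_lt_zero]
    exact mul_pos (inv_pos.2 ht) hNN
  · exact (hV.cfc_real _).smul_left _

end

theorem isOptimalWernerWitness_iff {d r : ℕ} (B : TensorMat d (r + 1)) :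
    IsOptimalWernerWitness B ↔ IsOptimalTraceInequality (inducedMap B) ∧ ¬ B.PosSemidef := by
  rw [isOptimalTraceInequality_inducedMap_iff]
  constructor
  · rintro ⟨⟨hinv, hbp, σ, hσ, -, hlt⟩, hvan⟩
    exact ⟨⟨hinv, hbp, hvan⟩, fun h =>
      hlt.not_ge (trace_mul_nonneg_of_posSemidef h hσ.1.1)⟩
  · rintro ⟨⟨hinv, hbp, hvan⟩, hneg⟩
    obtain ⟨σ, hσ, hlt, hcomm⟩ := exists_state_trace_neg hbp.isHermitian hneg
    exact ⟨⟨hinv, hbp, σ, ⟨hσ, fun hsep => hlt.not_ge (hbp σ hsep)⟩,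
      isUnitaryInvariant_of_commute fun U hU => hcomm _ (hinv.commute hU), hlt⟩, hvan⟩

end

theorem mainTheorem2 (d r : ℕ) :
    Set.BijOn (fun B : TensorMat d (r + 1) => inducedMap B)
      {B | IsUnitaryInvariant B ∧ IsBlockPositive B}
      {f : (Fin r → Mat d) → Mat d | IsTraceInequality f} ∧
    (∀ B : TensorMat d (r + 1),
      IsOptimalTraceInequality (inducedMap B) ↔
        IsUnitaryInvariant B ∧ IsBlockPositive B ∧ VanishesOnSeparable B) ∧
    (∀ B : TensorMat d (r + 1),
      IsOptimalWernerWitness B ↔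
        IsOptimalTraceInequality (inducedMap B) ∧ ¬ B.PosSemidef) :=
  ⟨bijOn_inducedMap d r, isOptimalTraceInequality_inducedMap_iff, isOptimalWernerWitness_iff⟩
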